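/- All graphs are finite, simple and undirected. Write $G\to H$ if there is a graph homomorphism from $G$ to $H$, and call $G,H$ homomorphically equivalent if $G\to H$ and $H\to G$. A graph is a *core* if all its endomorphisms are bijective; the *core of* $G$ is the (up to isomorphism unique) core homomorphically equivalent to $G$. A graph is *cubelike* if it is isomorphic to a Cayley graph $\mathrm{Cay}(\mathbb Z_2^n,C)$ with $n\ge 0$ and $0\notin C$. The $n$-cube is $Q_n=\mathrm{Cay}(\mathbb Z_2^n,\{e_1,\dots,e_n\})$, and for $n\ge 2$ the *folded cube of order $n$* is $\mathrm{Cay}(\mathbb Z_2^{n-1},\{e_1,\dots,e_{n-1},e_1+\cdots+e_{n-1}\})$. An *orbital graph* of $X$ is an undirected graph with vertex set $V(X)$ whose set of arcs is a union of non-diagonal orbits of $\mathrm{Aut}(X)$ on $V(X)\times V(X)$. A *covering map* is a surjective homomorphism that maps the neighbourhood of each vertex $u$ bijectively onto the neighbourhood of the image of $u$. A graph $G$ is *generously transitive* if any two vertices are interchanged by an automorphism, and *hom-idempotent* if it is homomorphically equivalent to its Cartesian square $G\mathbin{\square}G$. The *shift graph* of $G$ is $\mathrm{Cay}(\mathrm{Aut}(G),S)$,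 where $S$ consists of the automorphisms $\sigma$ with $\sigma(x)$ adjacent to $x$ for all $x$. The *cubelike hull* $\mathbb Z_2[G]$ has as vertices the vectors of even weight in $\mathbb Z_2^{V(G)}$, two of them being adjacent if their sum is $e_u+e_v$ for some edge $uv$ of $G$. The *odd girth* of a graph is the length of its shortest odd cycle ($\infty$ if it has none); $\omega,\chi,\alpha$ are the clique, chromatic and independence numbers. **Theorem.** Let $X$ be the core of a cubelike graph, and let $Y$ be a connected component of an orbital graph of $X$. Then $Y$ is regular and, writing $d$ for its valency, the following hold. 1. $Y$ is homomorphically equivalent to a cubelike graph, and $\omega(Y)\ne 3$, $\chi(Y)\neq 3$. 2. $Y$ is generously transitive. 3. There is a covering map from the $d$-cube $Q_d$ to $Y$, and $|V(Y)|\le 2^d$. 4. If $Y$ is a core other than $K_1$ and $K_2$, then $|V(Y)|\le 2^{d-1}$, with equality if and only if $d$ is odd and $Y$ is isomorphic to the folded cube of order $d$. 5. The eigenvalues of (the adjacency matrix of) $Y$ form a sub-multiset of those of $Q_d$, and are integers. 6. If $\alpha(Y)\,\omega(Y)=|V(Y)|$, then the core of $Y$ is a complete graph. 7. $Y$ is hom-idempotent.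 If $Y$ is a core, then $Y$ is hom-idempotent if and only if $Y$ is isomorphic to a subgraph of its shift graph. 8. For every graph $Z$, if $Z\to Y$ then $\mathbb Z_2[Z]\to Y$. 9. If $Y$ has finite odd girth $g$, then $Y$ contains the folded cube of order $g$ as an induced subgraph. -/

import Mathlib

universe u v w

namespace CubelikeCore

open SimpleGraph

section Homomorphisms

/-- `G → H`: there is a graph homomorphism from `G` to `H`. -/
def MapsTo {V : Type u} {W : Type v} (G : SimpleGraph V) (H : SimpleGraph W) : Prop :=
  Nonempty (G →g H)

/-- Homomorphic equivalence of graphs. -/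
def HomEquiv {V : Type u} {W : Type v} (G : SimpleGraph V) (H : SimpleGraph W) : Prop :=
  MapsTo G H ∧ MapsTo H G

/-- A graph is a core if all of its endomorphisms are bijections. -/
def IsCore {V : Type u} (G : SimpleGraph V) : Prop :=
  ∀ f : G →g G, Function.Bijective f

/-- `X` is the core of `G` (a graph has only one core up to isomorphism). -/
def IsCoreOf {V : Type u} {W : Type v} (X : SimpleGraph V) (G : SimpleGraph W) : Prop :=
  IsCore X ∧ HomEquiv X G

/-- A graph homomorphism is a covering map if it is surjective and maps the neighbourhood of
each vertex bijectively onto the neighbourhood of the image of that vertex. -/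
def IsGraphCovering {V : Type u} {W : Type v} {G : SimpleGraph V} {H : SimpleGraph W}
    (f : G →g H) : Prop :=
  Function.Surjective f ∧ ∀ x : V, Set.BijOn f (G.neighborSet x) (H.neighborSet (f x))

end Homomorphisms

section CubelikeGraphs

/-- A graph is cubelike if it is (isomorphic to) a Cayley graph of some `ℤ₂ⁿ`. -/
def IsCubelike {V : Type u} (G : SimpleGraph V) : Prop :=
  ∃ (n : ℕ) (C : Set (Fin n → ZMod 2)), (0 : Fin n → ZMod 2) ∉ C ∧
    Nonempty (G ≃g SimpleGraph.addCayley C)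

/-- The set of standard basis vectors of `ℤ₂ⁿ`. -/
def basisVectors (n : ℕ) : Set (Fin n → ZMod 2) :=
  {x | ∃ i : Fin n, x = Pi.single i 1}

/-- The `n`-cube `Q_n = Cay(ℤ₂ⁿ, {e₁, …, eₙ})`. -/
def cube (n : ℕ) : SimpleGraph (Fin n → ZMod 2) :=
  SimpleGraph.addCayley (basisVectors n)

/-- The folded cube of order `n ≥ 2`:
`Cay(ℤ₂ⁿ⁻¹, {e₁, …, eₙ₋₁, e₁ + ⋯ + eₙ₋₁})`. -/
def foldedCube (n : ℕ) : SimpleGraph (Fin (n - 1) → ZMod 2) :=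
  SimpleGraph.addCayley (basisVectors (n - 1) ∪ {∑ i : Fin (n - 1), Pi.single i 1})

open Classical in
/-- The cubelike hull `ℤ₂[G]` of a finite graph `G`: its vertices are the vectors of even weight
in `ℤ₂^V`, and two of them are adjacent if their sum is `e_a + e_b` for some edge `ab` of `G`. -/
def cubelikeHull {V : Type u} [Fintype V] (G : SimpleGraph V) :
    SimpleGraph {x : V → ZMod 2 // Even (hammingNorm x)} where
  Adj x y := ∃ a b : V, G.Adj a b ∧ x.1 + y.1 = Pi.single a 1 + Pi.single b 1
  symm := ⟨fun x y h => by
    obtain ⟨a, b, hab, h⟩ := h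
    exact ⟨a, b, hab, by rw [add_comm]; exact h⟩⟩
  loopless := ⟨fun x h => by
    obtain ⟨a, b, hab, h⟩ := h
    have h1 := congrFun h a
    simp [hab.ne, CharTwo.add_self_eq_zero] at h1⟩

end CubelikeGraphs

section Orbitals

/-- The orbital of the automorphism group of `X` containing `(a, b)`. -/
def orbital {V : Type u} (X : SimpleGraph V) (a b : V) : Set (V × V) :=
  {p | ∃ σ : X ≃g X, p = (σ a, σ b)}

/-- `O` is an orbital of the automorphism group of `X` that is not diagonal. -/
def IsNondiagonalOrbital {V : Type u} (X : SimpleGraph V) (O : Set (V × V)) : Prop :=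
  (∃ a b : V, O = orbital X a b) ∧ ¬ ∀ p ∈ O, p.1 = p.2

/-- `W` is an orbital graph of `X`: an undirected graph on the vertex set of `X` whose set of
arcs is a union of non-diagonal orbitals of the automorphism group of `X`. -/
def IsOrbitalGraph {V : Type u} (X W : SimpleGraph V) : Prop :=
  ∃ S : Set (Set (V × V)), (∀ O ∈ S, IsNondiagonalOrbital X O) ∧
    ∀ a b : V, W.Adj a b ↔ (a, b) ∈ ⋃₀ S

end Orbitals

section Properties

/-- Any two vertices are interchanged by some automorphism. -/
def GenerouslyTransitive {V : Type u} (G : SimpleGraph V) : Prop :=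
  ∀ a b : V, ∃ σ : G ≃g G, σ a = b ∧ σ b = a

/-- Every vertex of the (finite) graph `G` has exactly `d` neighbours. -/
def HasValency {V : Type u} (G : SimpleGraph V) (d : ℕ) : Prop :=
  ∀ x : V, (G.neighborSet x).ncard = d

open Classical in
/-- The multiset of eigenvalues of the adjacency matrix of a finite graph. -/
noncomputable def eigenvalues {V : Type u} [Finite V] (G : SimpleGraph V) : Multiset ℝ :=
  letI := Fintype.ofFinite V
  (G.adjMatrix ℝ).charpoly.roots

/-- `G` is homomorphically equivalent to its Cartesian square. -/
def HomIdempotent {V : Type u} (G : SimpleGraph V) : Prop :=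
  HomEquiv G (G □ G)

/-- The shifts of `G`: automorphisms mapping each vertex to one of its neighbours. -/
def shifts {V : Type u} (G : SimpleGraph V) : Set (G ≃g G) :=
  {σ | ∀ x : V, G.Adj (σ x) x}

/-- The shift graph of `G`, the Cayley graph of the automorphism group with connection set the
shifts. As this set is closed under conjugation, multiplying by shifts on the left and on the
right gives the same graph. -/
def shiftGraph {V : Type u} (G : SimpleGraph V) : SimpleGraph (G ≃g G) :=
  SimpleGraph.mulCayley (shifts G)

/-- The length of a shortest odd cycle, `⊤` if there is none. -/
noncomputable def oddGirth {V : Type u} (G : SimpleGraph V) : ℕ∞ :=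
  ⨅ (a : V) (c : G.Walk a a) (_ : c.IsCycle ∧ Odd c.length), (c.length : ℕ∞)

end Properties

end CubelikeCore

/-! Let `i : X → H` and `r : H → X` be homomorphisms, with `H` a Cayley graph of `ℤ₂ⁿ`, and correct
`r` so that `r ∘ i = id`. For every `g` the map `x ↦ r (i x + g)` is an endomorphism of the core
`X`, hence an automorphism, and so preserves every orbital graph. `TranslationRetract` keeps just
this: a retraction of an elementary abelian 2-group onto the vertices whose translations induce
automorphisms. It no longer mentions `X`, and it passes to connected components by
`nonempty_connectedComponent`.

The main consequence is `adj_ret_add`: adding `sec x + sec y`, for an edge `xy`, to a group element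
moves its image in `Y` to a neighbour. So sums in the group yield vertices, walks and homomorphisms
of `Y`. Walks become lists of generators, whose order is irrelevant to the endpoint; this gives the
parity argument against chromatic number 3 and the folded cubes from shortest odd cycles. The
generators at one vertex give the covering by the cube, and with it the eigenvalues and the bound on
the order. When that bound is attained and `Y` is a nonbipartite core, the covering has a deck
involution, and any such involution other than the antipodal map leads to a non-injective
endomorphism. The clique-coclique case comes from a tiling of the group by a clique and the preimage
of an independent set. -/

namespace CubelikeCore
open SimpleGraph

/-! ### Retractions of elementary abelian 2-groups onto graphs -/

section TranslationRetracts

/-- A retraction of a group `G` of exponent two onto the vertex set of a graph `Y`, with a section,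
such that the translations of `G` induce automorphisms of `Y`. -/
structure TranslationRetract {V : Type u} (Y : SimpleGraph V) (G : Type v) [AddCommGroup G] where
  /-- the section -/
  sec : V → G
  /-- the retraction -/
  ret : G → V
  ret_sec : ∀ x, ret (sec x) = x
  bijective_shift : ∀ g, Function.Bijective fun x => ret (sec x + g)
  adj_shift : ∀ g x y, Y.Adj (ret (sec x + g)) (ret (sec y + g)) ↔ Y.Adj x y

/-- The map induced on the finite set of arcs is injective, hence surjective. -/
theorem adj_iff_of_bijective {V : Type u} [Finite V] {G : SimpleGraph V} (f : G →g G)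
    (hf : Function.Bijective f) (a b : V) : G.Adj (f a) (f b) ↔ G.Adj a b := by
  refine ⟨fun h => ?_, f.map_adj⟩
  let F : {p : V × V // G.Adj p.1 p.2} → {p : V × V // G.Adj p.1 p.2} :=
    fun p => ⟨(f p.1.1, f p.1.2), f.map_adj p.2⟩
  have hF : Function.Injective F := by
    intro p q hpq
    simp only [F, Subtype.mk.injEq, Prod.mk.injEq] at hpq
    exact Subtype.ext (Prod.ext (hf.1 hpq.1) (hf.1 hpq.2))
  obtain ⟨⟨⟨a', b'⟩, h'⟩, hp⟩ := (Finite.injective_iff_surjective.1 hF) ⟨(f a, f b), h⟩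
  simp only [F, Subtype.mk.injEq, Prod.mk.injEq] at hp
  rw [← hf.1 hp.1, ← hf.1 hp.2]
  exact h'

/-- A bijective endomorphism of a finite graph, as an automorphism. -/
noncomputable def isoOfBijective {V : Type u} [Finite V] {G : SimpleGraph V} (f : G →g G)
    (hf : Function.Bijective f) : G ≃g G where
  toEquiv := Equiv.ofBijective f hf
  map_rel_iff' {a b} := adj_iff_of_bijective f hf a b

theorem IsOrbitalGraph.adj_iff {V : Type u} {X W : SimpleGraph V} (hW : IsOrbitalGraph X W)
    (σ : X ≃g X) (a b : V) : W.Adj (σ a) (σ b) ↔ W.Adj a b := by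
  obtain ⟨S, hS, hadj⟩ := hW
  have key : ∀ (τ : X ≃g X) (a b : V), W.Adj a b → W.Adj (τ a) (τ b) := by
    intro τ a b h
    rw [hadj] at h ⊢
    obtain ⟨O, hO, hab⟩ := h
    refine ⟨O, hO, ?_⟩
    obtain ⟨⟨c, d, rfl⟩, -⟩ := hS O hO
    obtain ⟨ρ, hρ⟩ := hab
    refine ⟨ρ.trans τ, ?_⟩
    simp only [Prod.mk.injEq] at hρ
    simp [hρ.1, hρ.2]
  refine ⟨fun h => ?_, key σ a b⟩
  simpa using key σ.symm _ _ h

theorem exists_translationRetract_orbitalGraph {V : Type u} [Finite V] {A : Type v}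
    {X : SimpleGraph V} {H : SimpleGraph A} (hH : IsCubelike H) (hX : IsCoreOf X H)
    {W : SimpleGraph V} (hW : IsOrbitalGraph X W) :
    ∃ n : ℕ, Nonempty (TranslationRetract W (Fin n → ZMod 2)) := by
  obtain ⟨n, C, -, ⟨e⟩⟩ := hH
  obtain ⟨hcore, ⟨i₀⟩, ⟨r₀⟩⟩ := hX
  let i : X →g addCayley C := e.toHom.comp i₀
  let r : addCayley C →g X := r₀.comp e.symm.toHom
  -- The composite `r ∘ i` is only an automorphism; following `r` by its inverse turns it into the
  -- identity.
  let ρ : X ≃g X := isoOfBijective (r.comp i) (hcore _)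
  have hρ : ∀ x, ρ x = r (i x) := fun x => rfl
  have shift : ∀ g, ∃ σ : X ≃g X, ∀ x, σ x = ρ.symm (r (i x + g)) := by
    intro g
    let f : X →g X := ⟨fun x => ρ.symm (r (i x + g)), by
      intro x y h
      refine ρ.symm.toHom.map_adj (r.map_adj ?_)
      rw [add_comm (i x), add_comm (i y), addCayley_adj_add_iff_right]
      exact i.map_adj h⟩
    exact ⟨isoOfBijective f (hcore f), fun x => rfl⟩
  refine ⟨n, ⟨⟨i, fun g => ρ.symm (r g), fun x => ?_, fun g => ?_, fun g x y => ?_⟩⟩⟩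
  · rw [← hρ, RelIso.symm_apply_apply]
  · obtain ⟨σ, hσ⟩ := shift g
    simpa only [← hσ] using σ.bijective
  · obtain ⟨σ, hσ⟩ := shift g
    simpa only [← hσ] using hW.adj_iff σ x y

variable {V : Type u} {Y : SimpleGraph V} {G : Type v} [AddCommGroup G]

namespace TranslationRetract

variable (R : TranslationRetract Y G)

/-- The automorphism of `Y` induced by a translation. -/
noncomputable def shift (g : G) : Y ≃g Y where
  toEquiv := Equiv.ofBijective _ (R.bijective_shift g)
  map_rel_iff' {a b} := R.adj_shift g a b

theorem shift_apply (g : G) (x : V) : R.shift g x = R.ret (R.sec x + g) := rfl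

/-- The connection set of the Cayley graph that retracts to `Y`. -/
def conn : Set G := {c | ∃ x y, Y.Adj x y ∧ c = R.sec x + R.sec y}

variable [Module (ZMod 2) G]

theorem adj_ret_add {c : G} (hc : c ∈ R.conn) (h : G) : Y.Adj (R.ret h) (R.ret (h + c)) := by
  obtain ⟨x, y, hxy, rfl⟩ := hc
  -- Translation by `h + sec x` sends `x` to `ret h` and `y` to `ret (h + c)`.
  have := (R.adj_shift (h + R.sec x) x y).2 hxy
  rwa [add_left_comm, ZModModule.add_self, add_zero,
    show R.sec y + (h + R.sec x) = h + (R.sec x + R.sec y) by abel] at this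

theorem zero_notMem_conn : (0 : G) ∉ R.conn := fun h => by
  have := R.adj_ret_add h 0
  rw [add_zero] at this
  exact this.ne rfl

theorem addCayley_conn_adj (g h : G) : (addCayley R.conn).Adj g h ↔ g + h ∈ R.conn := by
  rw [addCayley_adj, ZModModule.neg_eq_self, ZModModule.neg_eq_self, add_comm h g, or_self]
  refine ⟨fun h => h.2, fun hm => ⟨?_, hm⟩⟩
  rintro rfl
  rw [ZModModule.add_self] at hm
  exact R.zero_notMem_conn hm

/-- The retraction as a graph homomorphism. -/
def retHom : addCayley R.conn →g Y where
  toFun := R.ret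
  map_rel' {a b} h := by
    have := R.adj_ret_add ((R.addCayley_conn_adj a b).1 h) a
    rwa [← add_assoc, ZModModule.add_self, zero_add] at this

/-- The section as a graph homomorphism. -/
def secHom : Y →g addCayley R.conn where
  toFun := R.sec
  map_rel' {a b} h := (R.addCayley_conn_adj _ _).2 ⟨a, b, h, rfl⟩

theorem reachable_ret_add {s : G} (hs : s ∈ Submodule.span (ZMod 2) R.conn) :
    ∀ h, Y.Reachable (R.ret h) (R.ret (h + s)) := by
  induction hs using Submodule.span_induction with
  | mem c hc => exact fun h => (R.adj_ret_add hc h).reachable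
  | zero => intro h; rw [add_zero]
  | add a b _ _ ha hb => intro h; rw [← add_assoc]; exact (ha h).trans (hb _)
  | smul a x _ hx =>
    intro h
    obtain rfl | rfl : a = 0 ∨ a = 1 := by revert a; decide
    · rw [zero_smul, add_zero]
    · rw [one_smul]; exact hx h

theorem sec_add_sec_mem_span {x y : V} (h : Y.Reachable x y) :
    R.sec x + R.sec y ∈ Submodule.span (ZMod 2) R.conn := by
  obtain ⟨p⟩ := h
  induction p with
  | nil => rw [ZModModule.add_self]; exact zero_mem _
  | @cons a b c hab p ih =>
    have h1 : R.sec a + R.sec b ∈ Submodule.span (ZMod 2) R.conn :=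
      Submodule.subset_span ⟨a, b, hab, rfl⟩
    have h2 := add_mem h1 ih
    rwa [add_assoc, ← add_assoc (R.sec b), ZModModule.add_self, zero_add] at h2

/-- The span of `conn` moves vertices only within their components. Recentring at `y₀` puts the
section of the component into this span, and a linear projection `p` onto the span lets the whole
group `G` act, so the group need not change. -/
theorem nonempty_connectedComponent [Finite V] (R : TranslationRetract Y G)
    (K : Y.ConnectedComponent) :
    Nonempty (TranslationRetract (Y.induce K.supp) G) := by
  obtain ⟨y₀, hy₀⟩ := K.nonempty_supp
  obtain ⟨p, hp⟩ := LinearMap.exists_leftInverse_of_injective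
    (Submodule.span (ZMod 2) R.conn).subtype (by simp)
  have hp' : ∀ s (hs : s ∈ Submodule.span (ZMod 2) R.conn), (p s : G) = s := fun s hs =>
    congrArg Subtype.val (LinearMap.congr_fun hp ⟨s, hs⟩)
  have hmem : ∀ g, R.ret (p g + R.sec y₀) ∈ K.supp := by
    intro g
    have h := R.reachable_ret_add (p g).2 (R.sec y₀)
    rw [R.ret_sec, add_comm] at h
    rw [ConnectedComponent.mem_supp_iff] at hy₀ ⊢
    rw [← hy₀]
    exact (ConnectedComponent.sound h).symm
  have hspan : ∀ x ∈ K.supp, R.sec x + R.sec y₀ ∈ Submodule.span (ZMod 2) R.conn := by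
    intro x hx
    rw [ConnectedComponent.mem_supp_iff] at hy₀ hx
    exact R.sec_add_sec_mem_span (ConnectedComponent.exact (hx.trans hy₀.symm))
  have key : ∀ x ∈ K.supp, ∀ g, R.ret (p (R.sec x + R.sec y₀ + g) + R.sec y₀) =
      R.shift (p g) x := by
    intro x hx g
    rw [shift_apply, map_add, Submodule.coe_add, hp' _ (hspan x hx)]
    congr 1
    rw [show R.sec x + R.sec y₀ + (p g : G) + R.sec y₀ =
      R.sec x + p g + (R.sec y₀ + R.sec y₀) by abel, ZModModule.add_self, add_zero]
  refine ⟨⟨fun x => R.sec x + R.sec y₀, fun g => ⟨R.ret (p g + R.sec y₀), hmem g⟩,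
    fun x => ?_, fun g => ?_, fun g x y => ?_⟩⟩
  · apply Subtype.ext
    have := key x x.2 0
    rw [map_zero, add_zero, shift_apply, Submodule.coe_zero, add_zero, R.ret_sec] at this
    exact this
  · apply Function.Injective.bijective_of_finite
    intro x y hxy
    simp only [Subtype.mk.injEq] at hxy
    rw [key x x.2, key y y.2] at hxy
    exact Subtype.ext ((R.shift _).injective hxy)
  · simp only [comap_adj, Function.Embedding.subtype_apply]
    rw [key x x.2, key y y.2]
    exact (R.shift _).map_adj_iff

end TranslationRetract

end TranslationRetracts

/-! ### Winding numbers of 3-colourings -/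

section Winding

/-- The sign of the step from `a` to `b` in the triangle. -/
def turn (a b : ZMod 3) : ℤ := if b = a + 1 then 1 else -1

theorem turn_square : ∀ a b c d : ZMod 3, a ≠ b → b ≠ c → a ≠ d → d ≠ c →
    turn a b + turn b c = turn a d + turn d c := by decide

theorem turn_add_turn : ∀ a b : ZMod 3, a ≠ b → turn a b + turn b a = 0 := by decide

theorem odd_turn : ∀ a b : ZMod 3, Odd (turn a b) := by
  intro a b
  unfold turn
  split_ifs <;> decide

variable {G : Type v} [AddCommGroup G]

/-- The winding number along the triangle of the walk with given steps. -/
def winding (f : G → ZMod 3) : G → List G → ℤ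
  | _, [] => 0
  | x, c :: L => turn (f x) (f (x + c)) + winding f (x + c) L

theorem winding_append (f : G → ZMod 3) (L M : List G) (x : G) :
    winding f x (L ++ M) = winding f x L + winding f (x + L.sum) M := by
  induction L generalizing x with
  | nil => simp [winding]
  | cons c L ih => simp [winding, ih, add_assoc]

theorem even_winding_add_length (f : G → ZMod 3) (L : List G) (x : G) :
    Even (winding f x L + L.length) := by
  induction L generalizing x with
  | nil => simp [winding]
  | cons c L ih =>
    have h := (ih (x + c)).add ((odd_turn (f x) (f (x + c))).add_odd odd_one)
    simp only [winding, List.length_cons, Nat.cast_add, Nat.cast_one]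
    rwa [show turn (f x) (f (x + c)) + winding f (x + c) L + ((L.length : ℤ) + 1) =
      winding f (x + c) L + L.length + (turn (f x) (f (x + c)) + 1) by ring]

/-- Swapping consecutive steps moves the walk across a 4-cycle, and by `turn_square` both sides of
it wind equally. -/
theorem winding_perm {f : G → ZMod 3} {C : Set G} (hf : ∀ c ∈ C, ∀ x, f x ≠ f (x + c))
    {L M : List G} (h : L.Perm M) (hL : ∀ c ∈ L, c ∈ C) (x : G) :
    winding f x L = winding f x M := by
  induction h generalizing x with
  | nil => rfl
  | cons c _ ih => simp only [winding, ih (fun d hd => hL d (List.mem_cons_of_mem _ hd))]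
  | swap a b L =>
    have ha : a ∈ C := hL a (by simp)
    have hb : b ∈ C := hL b (by simp)
    have h := turn_square (f x) (f (x + b)) (f (x + b + a)) (f (x + a)) (hf b hb _) (hf a ha _)
      (hf a ha _) (by rw [add_right_comm]; exact hf b hb _)
    simp only [winding]
    rw [← add_assoc, h, add_right_comm x b a, add_assoc]
  | trans h₁ _ ih₁ ih₂ =>
    rw [ih₁ hL, ih₂ fun c hc => hL c (h₁.mem_iff.2 hc)]

variable [Module (ZMod 2) G]

/-- After reordering, equal steps are consecutive; such a pair goes along an edge and back, and
contributes nothing. -/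
theorem winding_append_self {f : G → ZMod 3} {C : Set G} (hf : ∀ c ∈ C, ∀ x, f x ≠ f (x + c))
    (L : List G) (hL : ∀ c ∈ L, c ∈ C) (x : G) : winding f x (L ++ L) = 0 := by
  induction L generalizing x with
  | nil => rfl
  | cons c L ih =>
    have hp : (c :: L ++ c :: L).Perm (c :: c :: (L ++ L)) :=
      List.Perm.cons c List.perm_middle
    rw [winding_perm hf hp fun d hd => hL d (by 
      rcases List.mem_append.1 hd with h | h <;> exact h)]
    have hc : c ∈ C := hL c (by simp)
    have h := turn_add_turn _ _ (hf c hc x)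
    simp only [winding, add_assoc x, ZModModule.add_self, add_zero]
    rw [← add_assoc, h, ih fun d hd => hL d (List.mem_cons_of_mem _ hd), add_zero]

/-- Since `L` returns to its start, `L ++ L` winds twice as much as `L`. Hence `L` has winding
number 0, which has the parity of its length. -/
theorem even_length_of_sum_eq_zero {f : G → ZMod 3} {C : Set G}
    (hf : ∀ c ∈ C, ∀ x, f x ≠ f (x + c)) (L : List G) (hL : ∀ c ∈ L, c ∈ C) (h0 : L.sum = 0) :
    Even L.length := by
  have h := winding_append_self hf L hL 0
  rw [winding_append, h0, add_zero] at h
  have h' := even_winding_add_length f L 0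
  rw [show winding f 0 L = 0 by lia, zero_add] at h'
  exact_mod_cast h'

end Winding

/-! ### Colourings, cliques, symmetry and homomorphisms -/

namespace TranslationRetract

variable {V : Type u} {Y : SimpleGraph V} {G : Type v} [AddCommGroup G]

theorem homIdempotent (R : TranslationRetract Y G) [Nonempty V] : HomIdempotent Y := by
  obtain ⟨y⟩ := ‹Nonempty V›
  refine ⟨⟨(boxProdLeft Y Y y).toHom⟩, ⟨⟨fun p => R.ret (R.sec p.1 + R.sec p.2), ?_⟩⟩⟩
  rintro ⟨a, b⟩ ⟨c, d⟩ h
  rw [boxProd_adj] at h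
  obtain ⟨h, rfl : b = d⟩ | ⟨h, rfl : a = c⟩ := h
  · exact (R.adj_shift _ _ _).2 h
  · simp only [add_comm (R.sec a)]
    exact (R.adj_shift _ _ _).2 h

theorem isContained_shiftGraph (R : TranslationRetract Y G) : IsContained Y (shiftGraph Y) := by
  -- By commutativity, `shift (sec a)` and `shift (sec b)` take `x` to the images of `a` and `b`
  -- under the single automorphism `shift (sec x)`.
  have hshift : ∀ a b, Y.Adj a b → (R.shift (R.sec a))⁻¹ * R.shift (R.sec b) ∈ shifts Y := by
    intro a b hab x
    rw [← (R.shift (R.sec a)).map_adj_iff]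
    change Y.Adj (R.shift (R.sec a) ((R.shift (R.sec a)).symm (R.shift (R.sec b) x))) _
    rw [RelIso.apply_symm_apply, shift_apply, shift_apply, add_comm, add_comm _ (R.sec a)]
    exact (R.adj_shift _ _ _).2 hab.symm
  have hinj : Function.Injective fun y => R.shift (R.sec y) := by
    intro a b hab
    have h := DFunLike.congr_fun hab a
    simp only [shift_apply] at h
    rw [add_comm _ (R.sec b)] at h
    exact (R.bijective_shift _).1 h
  refine ⟨⟨⟨fun y => R.shift (R.sec y), ?_⟩, hinj⟩⟩
  intro a b hab
  exact (mulCayley_adj _ _ _).2 ⟨fun h => hab.ne (hinj h), Or.inl (hshift a b hab)⟩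

variable [Module (ZMod 2) G]

theorem exists_list_of_walk (R : TranslationRetract Y G) {a b : V} (p : Y.Walk a b) :
    ∃ L : List G, (∀ c ∈ L, c ∈ R.conn) ∧ L.length = p.length ∧ L.sum = R.sec a + R.sec b := by
  induction p with
  | nil => exact ⟨[], by simp, rfl, by simp [ZModModule.add_self]⟩
  | @cons a b c hab p ih =>
    obtain ⟨L, h1, h2, h3⟩ := ih
    refine ⟨(R.sec a + R.sec b) :: L, ?_, by simp [h2], ?_⟩
    · rintro d (_ | ⟨_, hd⟩)
      · exact ⟨a, b, hab, rfl⟩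
      · exact h1 d hd
    · rw [List.sum_cons, h3, add_assoc, ← add_assoc (R.sec b), ZModModule.add_self, zero_add]

theorem exists_walk_of_list (R : TranslationRetract Y G) (L : List G) (hL : ∀ c ∈ L, c ∈ R.conn) (h : G) :
    ∃ p : Y.Walk (R.ret h) (R.ret (h + L.sum)), p.length = L.length := by
  induction L generalizing h with
  | nil => exact ⟨Walk.nil.copy rfl (by simp), by rw [Walk.length_copy]; rfl⟩
  | cons c L ih =>
    obtain ⟨p, hp⟩ := ih (fun d hd => hL d (List.mem_cons_of_mem _ hd)) (h + c)
    refine ⟨(Walk.cons (R.adj_ret_add (hL c (by simp)) h) p).copy rfl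
      (by rw [List.sum_cons, add_assoc]), ?_⟩
    rw [Walk.length_copy, Walk.length_cons, hp, List.length_cons]

/-- A closed walk gives a zero-sum list of generators of the same length, and the 3-colouring pulls
back along `ret`. -/
theorem colorable_two_of_colorable_three (R : TranslationRetract Y G) (h : Y.Colorable 3) : Y.Colorable 2 := by
  obtain ⟨col⟩ := h
  rw [two_colorable_iff_forall_loop_even]
  intro a p
  obtain ⟨L, h1, h2, h3⟩ := R.exists_list_of_walk p
  rw [ZModModule.add_self] at h3
  rw [← h2]
  have : ∀ c ∈ R.conn, ∀ x, (col (R.ret x) : ZMod 3) ≠ col (R.ret (x + c)) :=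
    fun c hc x => col.valid (R.adj_ret_add hc x)
  exact even_length_of_sum_eq_zero (f := fun g => col (R.ret g)) this L h1 h3

theorem chromaticNumber_ne_three (R : TranslationRetract Y G) : Y.chromaticNumber ≠ 3 := by
  intro h
  have h3 : Y.Colorable 3 := chromaticNumber_le_iff_colorable.1 (by rw [h]; rfl)
  have h2 := (R.colorable_two_of_colorable_three h3).chromaticNumber_le
  rw [h] at h2
  exact absurd h2 (by decide)

theorem cliqueNum_ne_three (R : TranslationRetract Y G) [Finite V] : Y.cliqueNum ≠ 3 := by
  classical
  intro h
  obtain ⟨s, hs⟩ := Y.exists_isNClique_cliqueNum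
  rw [h] at hs
  have hs' := hs
  rw [is3Clique_iff] at hs'
  obtain ⟨x, y, z, hxy, hxz, hyz, rfl⟩ := hs'
  have key : ∀ a b c, Y.Adj b c → Y.Adj (R.ret (R.sec a + (R.sec b + R.sec c))) a := by
    intro a b c hbc
    have := R.adj_ret_add ⟨b, c, hbc, rfl⟩ (R.sec a)
    rw [R.ret_sec] at this
    exact this.symm
  -- The image of the sum of the three vertices of a triangle is adjacent to all of them, giving a
  -- 4-clique.
  have h4 := hs.insert (a := R.ret (R.sec x + (R.sec y + R.sec z))) (by
    intro b hb
    simp only [Finset.mem_insert, Finset.mem_singleton] at hb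
    obtain rfl | rfl | rfl := hb
    · exact key _ _ _ hyz
    · rw [add_left_comm]; exact key _ _ _ hxz
    · rw [show R.sec x + (R.sec y + R.sec b) = R.sec b + (R.sec x + R.sec y) by abel]
      exact key _ _ _ hxy)
  have := IsClique.card_le_cliqueNum (tc := h4.isClique)
  rw [h4.card_eq, h] at this
  lia

theorem generouslyTransitive (R : TranslationRetract Y G) : GenerouslyTransitive Y := by
  intro a b
  refine ⟨R.shift (R.sec a + R.sec b), ?_, ?_⟩
  · rw [shift_apply, ← add_assoc, ZModModule.add_self, zero_add, R.ret_sec]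
  · rw [shift_apply, add_left_comm, ZModModule.add_self, add_zero, R.ret_sec]

theorem exists_iso_apply_eq (R : TranslationRetract Y G) (a b : V) : ∃ σ : Y ≃g Y, σ a = b :=
  (R.generouslyTransitive a b).imp fun _ h => h.1

theorem hasValency (R : TranslationRetract Y G) (y : V) : HasValency Y (Y.neighborSet y).ncard := by
  intro x
  obtain ⟨σ, rfl⟩ := R.exists_iso_apply_eq y x
  rw [← Nat.card_coe_set_eq, ← Nat.card_coe_set_eq]
  exact (Nat.card_congr (σ.mapNeighborSet y)).symm

theorem homEquiv_addCayley (R : TranslationRetract Y G) : HomEquiv Y (addCayley R.conn) :=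
  ⟨⟨R.secHom⟩, ⟨R.retHom⟩⟩

theorem mapsTo_cubelikeHull (R : TranslationRetract Y G) {T : Type w} [Fintype T] {Z : SimpleGraph T} (h : MapsTo Z Y) :
    MapsTo (cubelikeHull Z) Y := by
  classical
  obtain ⟨f⟩ := h
  -- The homomorphism is extended linearly; an edge of the hull then changes the sum by an element
  -- of `conn`.
  refine ⟨⟨fun x => R.ret (∑ t, x.1 t • R.sec (f t)), ?_⟩⟩
  rintro x y ⟨a, b, hab, hxy⟩
  have hy : (∑ t, y.1 t • R.sec (f t)) =
      (∑ t, x.1 t • R.sec (f t)) + (R.sec (f a) + R.sec (f b)) := by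
    have hy' : y.1 = x.1 + (Pi.single a 1 + Pi.single b 1) := by
      rw [← hxy, ← add_assoc, ZModModule.add_self, zero_add]
    simp [hy', add_smul, Finset.sum_add_distrib, Pi.single_apply, ite_smul]
  rw [hy]
  exact R.adj_ret_add ⟨_, _, f.map_adj hab, rfl⟩ _

/-- Double counting of the pairs `(y, g)` with `ret (sec y + g) ∈ S`: for fixed `y` they form a
translate of the preimage of `S`, for fixed `g` a bijective preimage of `S`. -/
theorem card_ret_preimage_mul (R : TranslationRetract Y G) [Fintype V] [Fintype G] [DecidableEq V] (S : Finset V) :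
    (Finset.univ.filter fun g => R.ret g ∈ S).card * Fintype.card V =
      S.card * Fintype.card G := by
  have h := Finset.sum_card_bipartiteAbove_eq_sum_card_bipartiteBelow
    (s := (Finset.univ : Finset V)) (t := (Finset.univ : Finset G))
    (fun y g => R.ret (R.sec y + g) ∈ S)
  have h1 : ∀ y : V, (Finset.univ.bipartiteAbove (fun y g => R.ret (R.sec y + g) ∈ S) y).card =
      (Finset.univ.filter fun g => R.ret g ∈ S).card := by
    intro y
    refine Finset.card_bij (fun g _ => R.sec y + g) (by simp [Finset.bipartiteAbove]) (by simp) ?_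
    intro g hg
    exact ⟨R.sec y + g, by
      simpa [Finset.bipartiteAbove, ← add_assoc, ZModModule.add_self] using hg,
      by rw [← add_assoc, ZModModule.add_self, zero_add]⟩
  have h2 : ∀ g : G, (Finset.univ.bipartiteBelow (fun y g => R.ret (R.sec y + g) ∈ S) g).card =
      S.card := by
    intro g
    refine Finset.card_bij (fun y _ => R.shift g y) ?_ (by simp) ?_
    · intro y hy
      simpa [Finset.bipartiteBelow, shift_apply] using hy
    · intro y hy
      refine ⟨(R.shift g).symm y, Finset.mem_filter.2 ⟨Finset.mem_univ _, ?_⟩, by simp⟩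
      beta_reduce
      rw [← shift_apply, RelIso.apply_symm_apply]
      exact hy
  simp only [h1, h2, Finset.sum_const, Finset.card_univ, smul_eq_mul] at h
  rw [mul_comm, h, mul_comm]

/-- Let `P` be the preimage of a maximum independent set and `K` a maximum clique. The sums `sec k +
p` are distinct, and by the hypothesis as numerous as the elements of `G`, so `K` and `P` tile `G`.
The `K`-part of `sec y` is then a proper colouring of `Y` with `ω` colours. -/
theorem exists_isCoreOf_completeGraph (R : TranslationRetract Y G) [Finite V] [Finite G] [Nonempty V]
    (h : Y.indepNum * Y.cliqueNum = Nat.card V) :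
    ∃ m : ℕ, IsCoreOf (completeGraph (Fin m)) Y := by
  classical
  have := Fintype.ofFinite V
  have := Fintype.ofFinite G
  obtain ⟨S, hS⟩ := Y.exists_isNIndepSet_indepNum
  obtain ⟨K, hK⟩ := Y.exists_isNClique_cliqueNum
  let P := {g : G // R.ret g ∈ S}
  have hne : ∀ g g' : P, ¬ (g : G) + g' ∈ R.conn := by
    intro g g' hc
    have hadj := R.adj_ret_add hc g
    rw [← add_assoc, ZModModule.add_self, zero_add] at hadj
    exact hS.isIndepSet g.2 g'.2 hadj.ne hadj
  let F : K × P → G := fun p => R.sec p.1 + p.2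
  have hinj : Function.Injective F := by
    rintro ⟨k, g⟩ ⟨k', g'⟩ hkg
    have hkg' : R.sec k + g.1 = R.sec k' + g'.1 := hkg
    have hk : k = k' := by
      by_contra hkk
      apply hne g g'
      refine ⟨k, k', hK.isClique k.2 k'.2 (fun h => hkk (Subtype.ext h)), ?_⟩
      calc (g : G) + g' = R.sec k + (R.sec k + g) + g' := by
            rw [← add_assoc, ZModModule.add_self, zero_add]
        _ = R.sec k + R.sec k' + (g' + g') := by rw [hkg']; abel
        _ = R.sec k + R.sec k' := by rw [ZModModule.add_self, add_zero]
    subst hk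
    exact Prod.ext rfl (Subtype.ext (add_left_cancel hkg'))
  have hcard : Fintype.card (K × P) = Fintype.card G := by
    have h1 := R.card_ret_preimage_mul S
    rw [Nat.card_eq_fintype_card] at h
    have h2 : Fintype.card P = (Finset.univ.filter fun g => R.ret g ∈ S).card :=
      Fintype.card_subtype _
    have hpos : 0 < Fintype.card V := Fintype.card_pos
    rw [Fintype.card_prod, Fintype.card_coe, h2, hK.card_eq]
    apply Nat.eq_of_mul_eq_mul_right hpos
    rw [mul_assoc, h1, hS.card_eq, ← h]
    ring
  have hbij : Function.Bijective F := (Fintype.bijective_iff_injective_and_card F).2 ⟨hinj, hcard⟩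
  obtain ⟨E, hE⟩ := hbij.2.hasRightInverse
  have hE' : ∀ g, R.sec (E g).1 + (E g).2 = g := hE
  have col : Y.Coloring K := Coloring.mk (fun y => (E (R.sec y)).1) (by
    -- If the `K`-parts agree, the `P`-parts differ by `sec x + sec y ∈ conn`, which `hne` forbids.
    intro x y hxy hEq
    refine hne (E (R.sec x)).2 (E (R.sec y)).2 ⟨x, y, hxy, ?_⟩
    conv_rhs => rw [← hE' (R.sec x), ← hE' (R.sec y), hEq]
    rw [add_add_add_comm, ZModModule.add_self, zero_add])
  have ecard : Fintype.card K = Fintype.card (Fin Y.cliqueNum) := by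
    rw [Fintype.card_coe, hK.card_eq, Fintype.card_fin]
  let e : K ≃ Fin Y.cliqueNum := Fintype.equivOfCardEq ecard
  refine ⟨Y.cliqueNum, ?_, ⟨⟨fun m => (e.symm m).1, ?_⟩⟩, ⟨⟨fun y => e (col y), ?_⟩⟩⟩
  · intro f
    apply Function.Injective.bijective_of_finite
    intro a b hab
    by_contra hne
    exact (f.map_adj (v := a) (w := b) hne).ne hab
  · intro a b hab
    exact hK.isClique (e.symm a).2 (e.symm b).2 fun h => hab (e.symm.injective (Subtype.ext h))
  · intro a b hab h
    exact col.valid hab (e.injective h)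

end TranslationRetract

/-! ### Coverings and eigenvalues -/

section Coverings

variable {V : Type u} {W : Type v} {G : SimpleGraph V} {H : SimpleGraph W}

theorem surjective_of_surjOn_neighborSet [Nonempty V] (hH : H.Preconnected) (f : G →g H)
    (hf : ∀ x, Set.SurjOn f (G.neighborSet x) (H.neighborSet (f x))) : Function.Surjective f := by
  have key : ∀ a b : W, H.Walk a b → a ∈ Set.range f → b ∈ Set.range f := by
    intro a b p
    induction p with
    | nil => exact id
    | cons hab p ih =>
      rintro ⟨x, rfl⟩
      obtain ⟨y, -, hy⟩ := hf x hab
      exact ih ⟨y, hy⟩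
  obtain ⟨x⟩ := ‹Nonempty V›
  intro b
  obtain ⟨p⟩ := hH (f x) b
  exact key _ _ p ⟨x, rfl⟩

open Classical in
theorem IsGraphCovering.adjMatrix_mulVec_comp [Fintype V] [Fintype W] {f : G →g H}
    (hf : IsGraphCovering f) (v : W → ℝ) :
    (G.adjMatrix ℝ).mulVec (v ∘ f) = (H.adjMatrix ℝ).mulVec v ∘ f := by
  ext x
  rw [Function.comp_apply, adjMatrix_mulVec_apply, adjMatrix_mulVec_apply]
  obtain ⟨h1, h2, h3⟩ := hf.2 x
  refine Finset.sum_nbij f ?_ ?_ ?_ (fun _ _ => rfl)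
  · intro y hy
    simpa using h1 (by simpa using hy)
  · simpa using h2
  · simpa using h3

/-- Generalized eigenspaces are used because their dimensions are the root multiplicities of the
characteristic polynomial. -/
theorem finrank_maxGenEigenspace_le_of_comp_eq {M N : Type*} [AddCommGroup M] [Module ℝ M]
    [FiniteDimensional ℝ M] [AddCommGroup N] [Module ℝ N] (A : Module.End ℝ M)
    (B : Module.End ℝ N) (T : N →ₗ[ℝ] M) (hT : Function.Injective T)
    (h : ∀ v, A (T v) = T (B v)) (t : ℝ) :
    Module.finrank ℝ (B.maxGenEigenspace t) ≤ Module.finrank ℝ (A.maxGenEigenspace t) := by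
  have hpow : ∀ (k : ℕ) v, ((A - t • 1) ^ k) (T v) = T (((B - t • 1) ^ k) v) := by
    intro k
    induction k with
    | zero => intro v; rfl
    | succ k ih =>
      intro v
      rw [pow_succ, pow_succ, Module.End.mul_apply, Module.End.mul_apply, ← ih]
      simp [h]
  let T' : B.maxGenEigenspace t →ₗ[ℝ] A.maxGenEigenspace t := T.restrict fun v hv => by
    rw [Module.End.mem_maxGenEigenspace] at hv ⊢
    obtain ⟨k, hk⟩ := hv
    exact ⟨k, by rw [hpow, hk, map_zero]⟩
  refine LinearMap.finrank_le_finrank_of_injective (f := T') fun a b hab => ?_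
  exact Subtype.ext (hT (congrArg Subtype.val hab))

theorem IsGraphCovering.eigenvalues_le [Finite V] [Finite W] {f : G →g H}
    (hf : IsGraphCovering f) : eigenvalues H ≤ eigenvalues G := by
  classical
  let := Fintype.ofFinite V
  let := Fintype.ofFinite W
  rw [Multiset.le_iff_count]
  intro t
  unfold eigenvalues
  rw [Polynomial.count_roots, Polynomial.count_roots, ← Matrix.charpoly_toLin',
    ← Matrix.charpoly_toLin', ← LinearMap.finrank_maxGenEigenspace_eq,
    ← LinearMap.finrank_maxGenEigenspace_eq]
  -- Pulling functions back along the covering is injective and intertwines the two adjacency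
  -- operators.
  refine finrank_maxGenEigenspace_le_of_comp_eq _ _ (LinearMap.funLeft ℝ ℝ f)
    (LinearMap.funLeft_injective_of_surjective _ _ _ hf.1) (fun v => ?_) t
  have := hf.adjMatrix_mulVec_comp v
  exact this

open Classical in
theorem exists_eigenvector_of_mem_eigenvalues [Finite V] {t : ℝ} (ht : t ∈ eigenvalues G) :
    letI := Fintype.ofFinite V
    ∃ v : V → ℝ, v ≠ 0 ∧ (G.adjMatrix ℝ).mulVec v = t • v := by
  let := Fintype.ofFinite V
  have hroot := Polynomial.isRoot_of_mem_roots ht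
  rw [← Matrix.charpoly_toLin', ← Module.End.hasEigenvalue_iff_isRoot_charpoly] at hroot
  obtain ⟨v, hv⟩ := hroot.exists_hasEigenvector
  exact ⟨v, hv.2, hv.apply_eq_smul⟩

end Coverings

/-! ### Integrality of the spectrum of the cube -/

section Cube

theorem cube_adj {n : ℕ} (x y : Fin n → ZMod 2) :
    (cube n).Adj x y ↔ ∃ j, y = x + Pi.single j 1 := by
  rw [cube, addCayley_adj, ZModModule.neg_eq_self, ZModModule.neg_eq_self, add_comm y x, or_self]
  constructor
  · rintro ⟨-, j, hj⟩
    exact ⟨j, by rw [← hj, ← add_assoc, ZModModule.add_self, zero_add]⟩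
  · rintro ⟨j, rfl⟩
    refine ⟨fun h => ?_, j, by rw [← add_assoc, ZModModule.add_self, zero_add]⟩
    have := congrFun h j
    simp at this

theorem cube_adj_add_single {n : ℕ} (x : Fin n → ZMod 2) (j : Fin n) :
    (cube n).Adj x (x + Pi.single j 1) := (cube_adj _ _).2 ⟨j, rfl⟩

theorem add_single_injective {n : ℕ} (x : Fin n → ZMod 2) :
    Function.Injective fun j : Fin n => x + Pi.single j (1 : ZMod 2) := by
  intro j k h
  have h' := congrFun (add_left_cancel h) j
  by_contra hne
  simp [hne] at h'

theorem cube_adjMatrix_mulVec {n : ℕ} [Fintype (Fin n → ZMod 2)] [DecidableRel (cube n).Adj] (v : (Fin n → ZMod 2) → ℝ)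
    (x : Fin n → ZMod 2) :
    ((cube n).adjMatrix ℝ).mulVec v x = ∑ j, v (x + Pi.single j 1) := by
  classical
  rw [adjMatrix_mulVec_apply]
  have : (cube n).neighborFinset x = Finset.univ.image fun j : Fin n => x + Pi.single j 1 := by
    ext y
    simp [cube_adj, eq_comm]
  rw [this, Finset.sum_image (add_single_injective x).injOn]

/-- The coordinate flips are commuting involutions that commute with the adjacency operator. Adding
to a vector its flip makes it invariant; if the sum vanishes, the vector was already an eigenvector
for -1. -/
theorem exists_simultaneous_eigenvector {n : ℕ} {v : (Fin n → ZMod 2) → ℝ} {t : ℝ} (hv : v ≠ 0)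
    (h : ∀ x, ∑ j, v (x + Pi.single j 1) = t * v x) (S : Finset (Fin n)) :
    ∃ v : (Fin n → ZMod 2) → ℝ, v ≠ 0 ∧ (∀ x, ∑ j, v (x + Pi.single j 1) = t * v x) ∧
      ∀ j ∈ S, ∃ s : ℤ, ∀ x, v (x + Pi.single j 1) = s * v x := by
  classical
  induction S using Finset.induction_on with
  | empty => exact ⟨v, hv, h, by simp⟩
  | insert i S _ ih =>
    obtain ⟨w, hw, h1, h2⟩ := ih
    by_cases h0 : ∀ x, w x + w (x + Pi.single i 1) = 0
    · refine ⟨w, hw, h1, fun j hj => ?_⟩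
      obtain rfl | hj := Finset.mem_insert.1 hj
      · exact ⟨-1, fun x => by push_cast; linarith [h0 x]⟩
      · exact h2 j hj
    · refine ⟨fun x => w x + w (x + Pi.single i 1), fun h => h0 fun x => congrFun h x, ?_, ?_⟩
      · intro x
        rw [Finset.sum_add_distrib, mul_add, ← h1, ← h1]
        simp only [add_right_comm]
      · intro j hj
        obtain rfl | hj := Finset.mem_insert.1 hj
        · refine ⟨1, fun x => ?_⟩
          beta_reduce
          rw [add_assoc x, ZModModule.add_self, add_zero, Int.cast_one, one_mul, add_comm]
        · obtain ⟨s, hs⟩ := h2 j hj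
          refine ⟨s, fun x => ?_⟩
          beta_reduce
          rw [add_right_comm, hs, hs, mul_add]

theorem exists_int_of_mem_eigenvalues_cube {n : ℕ} {t : ℝ} (ht : t ∈ eigenvalues (cube n)) :
    ∃ k : ℤ, t = k := by
  classical
  obtain ⟨v, hv0, hv⟩ := exists_eigenvector_of_mem_eigenvalues ht
  let := Fintype.ofFinite (Fin n → ZMod 2)
  have hv' : ∀ x, ∑ j, v (x + Pi.single j 1) = t * v x := by
    intro x
    rw [← cube_adjMatrix_mulVec]
    exact congrFun hv x
  obtain ⟨w, hw, h1, h2⟩ := exists_simultaneous_eigenvector hv0 hv' Finset.univ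
  choose s hs using fun j => h2 j (Finset.mem_univ j)
  obtain ⟨x, hx⟩ := Function.ne_iff.1 hw
  refine ⟨∑ j, s j, ?_⟩
  have := h1 x
  simp only [hs, ← Finset.sum_mul] at this
  push_cast
  exact (mul_right_cancel₀ hx this).symm

end Cube

/-! ### The covering by the cube -/

namespace TranslationRetract

variable {V : Type u} {Y : SimpleGraph V} {G : Type v} [AddCommGroup G] [Module (ZMod 2) G]

/-- Each coordinate stands for one neighbour of `y₀`. The automorphism `shift (s x)` takes `y₀` to
`f x` and its neighbours to the images of the neighbours of `x`, so bijectivity at `y₀` carries over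
to every `x`. -/
theorem exists_isGraphCovering_cube [Finite V] [Nonempty V] (R : TranslationRetract Y G)
    (hY : Y.Preconnected) {d : ℕ} (hd : HasValency Y d) :
    ∃ f : cube d →g Y, IsGraphCovering f := by
  obtain ⟨y₀⟩ := ‹Nonempty V›
  have e : Fin d ≃ Y.neighborSet y₀ :=
    (Finite.equivFinOfCardEq ((Nat.card_coe_set_eq _).trans (hd y₀))).symm
  let c : Fin d → G := fun j => R.sec y₀ + R.sec (e j)
  let s : (Fin d → ZMod 2) → G := fun x => ∑ j, x j • c j
  have hs : ∀ x j, s (x + Pi.single j 1) = s x + c j := by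
    intro x j
    simp [s, add_smul, Finset.sum_add_distrib, Pi.single_apply, ite_smul]
  have hc : ∀ j, c j ∈ R.conn := fun j => ⟨y₀, e j, (e j).2, rfl⟩
  let f : cube d →g Y := ⟨fun x => R.ret (R.sec y₀ + s x), by
    intro x y h
    obtain ⟨j, rfl⟩ := (cube_adj _ _).1 h
    rw [hs, ← add_assoc]
    exact R.adj_ret_add (hc j) _⟩
  have hf : ∀ x, f x = R.shift (s x) y₀ := fun x => rfl
  have hf' : ∀ x j, f (x + Pi.single j 1) = R.shift (s x) (e j) := by
    intro x j
    change R.ret (R.sec y₀ + s (x + Pi.single j 1)) = _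
    rw [hs, R.shift_apply, show R.sec y₀ + (s x + c j) =
      (R.sec y₀ + R.sec y₀) + (R.sec (e j) + s x) by simp only [c]; abel, ZModModule.add_self,
      zero_add]
  have hbij : ∀ x, Set.BijOn f ((cube d).neighborSet x) (Y.neighborSet (f x)) := by
    intro x
    refine ⟨fun y hy => f.map_adj hy, ?_, ?_⟩
    · intro a ha b hb hab
      obtain ⟨j, rfl⟩ := (cube_adj _ _).1 ha
      obtain ⟨k, rfl⟩ := (cube_adj _ _).1 hb
      rw [hf', hf'] at hab
      rw [e.injective (Subtype.ext ((R.shift _).injective hab))]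
    · intro v hv
      have hv' : Y.Adj y₀ ((R.shift (s x)).symm v) := by
        rw [← (R.shift (s x)).map_adj_iff, RelIso.apply_symm_apply]
        exact hv
      refine ⟨x + Pi.single (e.symm ⟨_, hv'⟩) 1, cube_adj_add_single _ _, ?_⟩
      rw [hf', Equiv.apply_symm_apply, RelIso.apply_symm_apply]
  exact ⟨f, surjective_of_surjOn_neighborSet hY f fun x => (hbij x).surjOn, hbij⟩

end TranslationRetract

theorem IsGraphCovering.card_le_two_pow {V : Type u} {Y : SimpleGraph V} {d : ℕ}
    {f : cube d →g Y} (hf : IsGraphCovering f) : Nat.card V ≤ 2 ^ d := by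
  have := Nat.card_le_card_of_surjective f hf.1
  simpa using this

/-! ### Bipartite cores -/

section BipartiteCores

variable {V : Type u} {Y : SimpleGraph V}

theorem IsCore.nonempty_iso_of_colorable_two [Finite V] [Nonempty V] (hY : IsCore Y)
    (h : Y.Colorable 2) :
    Nonempty (Y ≃g completeGraph (Fin 1)) ∨ Nonempty (Y ≃g completeGraph (Fin 2)) := by
  by_cases hE : ∃ u v, Y.Adj u v
  · right
    obtain ⟨u, v, huv⟩ := hE
    obtain ⟨col⟩ := h
    let g : completeGraph (Fin 2) →g Y := ⟨fun m => if m = 0 then u else v, by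
      intro a b hab
      have hab' : a ≠ b := hab
      fin_cases a <;> fin_cases b <;> simp_all [huv.symm]⟩
    -- The endomorphism factors through `K₂`, so the colouring must be injective.
    have hbij := hY (g.comp col)
    have hinj : Function.Injective col := Function.Injective.of_comp (f := g) hbij.1
    have hsurj : Function.Surjective col := by
      have huv' := col.valid huv
      intro m
      by_cases hm : m = col u
      · exact ⟨u, hm.symm⟩
      · exact ⟨v, by omega⟩
    refine ⟨⟨Equiv.ofBijective col ⟨hinj, hsurj⟩, ?_⟩⟩
    intro a b
    refine ⟨fun hab => ?_, fun hab => col.valid hab⟩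
    rw [← adj_iff_of_bijective (g.comp col) hbij]
    exact g.map_adj hab
  · left
    push Not at hE
    obtain ⟨y⟩ := ‹Nonempty V›
    have hc := hY ⟨fun _ => y, fun {a b} hab => absurd hab (hE a b)⟩
    have hsub : Subsingleton V := ⟨fun a b => hc.1 rfl⟩
    have : Unique V := ⟨⟨y⟩, fun a => Subsingleton.elim _ _⟩
    exact ⟨⟨Equiv.ofUnique V (Fin 1), fun {a b} =>
      ⟨fun hab => absurd (Subsingleton.elim _ _) hab.ne, fun hab => absurd hab (hE a b)⟩⟩⟩

end BipartiteCores

/-! ### Quotients of the cube and the extremal case -/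

section CubeQuotients

theorem cube_induction {n : ℕ} {P : (Fin n → ZMod 2) → Prop} (x₀ : Fin n → ZMod 2) (h0 : P x₀)
    (h : ∀ x j, P x → P (x + Pi.single j 1)) (x : Fin n → ZMod 2) : P x := by
  classical
  have key : ∀ S : Finset (Fin n), P (x₀ + ∑ j ∈ S, Pi.single j 1) := by
    intro S
    induction S using Finset.induction_on with
    | empty => simpa using h0
    | insert i S hi ih =>
      rw [Finset.sum_insert hi, add_left_comm, add_comm]
      exact h _ _ ih
  have hz : ∀ z : ZMod 2, z = if z ≠ 0 then 1 else 0 := by decide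
  have hx : x = x₀ + ∑ j ∈ Finset.univ.filter (fun j => (x₀ + x) j ≠ 0), Pi.single j 1 := by
    have : (∑ j ∈ Finset.univ.filter (fun j => (x₀ + x) j ≠ 0), Pi.single j (1 : ZMod 2)) =
        x₀ + x := by
      ext i
      rw [Finset.sum_apply, hz ((x₀ + x) i)]
      simp [Pi.single_apply]
    rw [this, ← add_assoc, ZModModule.add_self, zero_add]
  rw [hx]
  exact key _

variable {V : Type u} {Y : SimpleGraph V} {d : ℕ} {f : cube d →g Y}

namespace IsGraphCovering

theorem exists_lift_adj (hf : IsGraphCovering f) {x : Fin d → ZMod 2} {v : V}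
    (h : Y.Adj (f x) v) : ∃ j, f (x + Pi.single j 1) = v := by
  obtain ⟨y, hy, rfl⟩ := (hf.2 x).surjOn h
  obtain ⟨j, rfl⟩ := (cube_adj _ _).1 hy
  exact ⟨j, rfl⟩

theorem eq_of_apply_eq (hf : IsGraphCovering f) {x y : Fin d → ZMod 2} {j k : Fin d}
    (hxy : x + Pi.single j 1 = y + Pi.single k 1) (h : f x = f y) : x = y := by
  refine (hf.2 (x + Pi.single j 1)).injOn (cube_adj_add_single x j).symm ?_ h
  rw [hxy]
  exact (cube_adj_add_single y k).symm

theorem eq_of_apply_add_single_eq (hf : IsGraphCovering f) {x : Fin d → ZMod 2} {j k : Fin d}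
    (h : f (x + Pi.single j 1) = f (x + Pi.single k 1)) : j = k :=
  add_single_injective x
    ((hf.2 x).injOn (cube_adj_add_single x j) (cube_adj_add_single x k) h)

/-- If parity is constant on fibres, it descends to a proper 2-colouring of `Y`. -/
theorem colorable_two (hf : IsGraphCovering f)
    (h : ∀ x y, f x = f y → ∑ j, x j = ∑ j, y j) : Y.Colorable 2 := by
  have col : Y.Coloring (ZMod 2) :=
    Coloring.mk (fun v => ∑ j, Function.surjInv hf.1 v j) (by
      intro a b hab he
      rw [← Function.surjInv_eq hf.1 a] at hab
      obtain ⟨j, hj⟩ := hf.exists_lift_adj hab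
      have h1 := h _ _ (hj.trans (Function.surjInv_eq hf.1 b).symm)
      simp [Finset.sum_add_distrib, he] at h1)
  exact col.colorable

/-- An injective `f` would make `Y` bipartite, so some fibre has two points; lifting edges at both
of them carries this along the cube. -/
theorem exists_ne_apply_eq (hf : IsGraphCovering f) (hY : ¬ Y.Colorable 2)
    (x : Fin d → ZMod 2) : ∃ y, y ≠ x ∧ f y = f x := by
  have h : ∃ x y, f x = f y ∧ x ≠ y := by
    by_contra! h
    exact hY (hf.colorable_two fun x y hxy => congrArg (fun z => ∑ j, z j) (h x y hxy))
  obtain ⟨x₀, y₀, h, hne⟩ := h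
  refine cube_induction (P := fun x => ∃ y, y ≠ x ∧ f y = f x) x₀ ⟨y₀, hne.symm, h.symm⟩ ?_ x
  rintro x j ⟨y, hyx, hy⟩
  have hadj : Y.Adj (f y) (f (x + Pi.single j 1)) := by
    rw [hy]
    exact f.map_adj (cube_adj_add_single x j)
  obtain ⟨k, hk⟩ := hf.exists_lift_adj hadj
  exact ⟨_, fun he => hyx (hf.eq_of_apply_eq he hy), hk⟩

/-- The map that lists a point and a second point of each fibre. -/
theorem injective_fibre_pair (hf : IsGraphCovering f) {τ : (Fin d → ZMod 2) → Fin d → ZMod 2}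
    (hne : ∀ x, τ x ≠ x) (hτ : ∀ x, f (τ x) = f x) :
    Function.Injective fun p : V × Bool =>
      if p.2 then Function.surjInv hf.1 p.1 else τ (Function.surjInv hf.1 p.1) := by
  have hval : ∀ p : V × Bool,
      f (if p.2 then Function.surjInv hf.1 p.1 else τ (Function.surjInv hf.1 p.1)) = p.1 := by
    intro p
    split_ifs
    · exact Function.surjInv_eq hf.1 _
    · rw [hτ]; exact Function.surjInv_eq hf.1 _
  rintro ⟨a, b⟩ ⟨a', b'⟩ h
  have ha : a = a' := (hval (a, b)).symm.trans ((congrArg f h).trans (hval (a', b')))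
  subst ha
  cases b <;> cases b' <;> simp_all [(hne _).symm]

theorem card_mul_two_le (hf : IsGraphCovering f) (hY : ¬ Y.Colorable 2) :
    Nat.card V * 2 ≤ 2 ^ d := by
  choose τ hne hτ using hf.exists_ne_apply_eq hY
  have := Nat.card_le_card_of_injective _ (hf.injective_fibre_pair hne hτ)
  simpa using this

theorem eq_or_eq_of_card_mul_two_eq [Finite V] (hf : IsGraphCovering f)
    (hcard : Nat.card V * 2 = 2 ^ d)
    {τ : (Fin d → ZMod 2) → Fin d → ZMod 2} (hne : ∀ x, τ x ≠ x) (hτ : ∀ x, f (τ x) = f x)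
    (x y : Fin d → ZMod 2) (h : f y = f x) : y = x ∨ y = τ x := by
  have hinj := hf.injective_fibre_pair hne hτ
  have hsurj := ((Nat.bijective_iff_injective_and_card _).2 ⟨hinj, by simpa using hcard⟩).2
  have key : ∀ z, z = Function.surjInv hf.1 (f z) ∨ z = τ (Function.surjInv hf.1 (f z)) := by
    intro z
    obtain ⟨⟨a, b⟩, hz⟩ := hsurj z
    have ha : f z = a := by
      rw [← hz]
      cases b <;> simp [hτ, Function.surjInv_eq hf.1]
    rw [ha]
    cases b
    · right; simpa using hz.symm
    · left; simpa using hz.symm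
  have hx := key x
  have hy := key y
  have hx' := key (τ x)
  rw [hτ] at hx'
  rw [h] at hy
  have := hne x
  grind

/-- The map `τ` exchanging the two points of each fibre is an involutive automorphism of the cube,
hence affine: a permutation of coordinates followed by a translation. -/
theorem exists_perm_of_fibre_eq (hf : IsGraphCovering f)
    {τ : (Fin d → ZMod 2) → Fin d → ZMod 2} (hne : ∀ x, τ x ≠ x) (hτ : ∀ x, f (τ x) = f x)
    (hfib : ∀ x y, f y = f x → y = x ∨ y = τ x) :
    ∃ π : Fin d → Fin d, Function.Involutive π ∧ (∀ x j, τ x j = τ 0 j + x (π j)) ∧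
      ∀ j, τ 0 (π j) = τ 0 j := by
  have hττ : ∀ x, τ (τ x) = x := fun x =>
    (hfib (τ x) x (hτ x).symm).elim (fun h => absurd h.symm (hne x)) Eq.symm
  have hσ : ∀ x j, ∃ k, τ (x + Pi.single j 1) = τ x + Pi.single k 1 := by
    intro x j
    have hadj : Y.Adj (f (τ x)) (f (x + Pi.single j 1)) := by
      rw [hτ]
      exact f.map_adj (cube_adj_add_single x j)
    obtain ⟨k, hk⟩ := hf.exists_lift_adj hadj
    refine ⟨k, ?_⟩
    obtain h | h := hfib _ _ hk
    · exact absurd (hf.eq_of_apply_eq h (hτ x)) (hne x)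
    · exact h.symm
  choose σ hσ using hσ
  have hσinj : ∀ x, Function.Injective (σ x) := by
    intro x j k hjk
    have h : τ (x + Pi.single j 1) = τ (x + Pi.single k 1) := by rw [hσ, hσ, hjk]
    have h' := congrArg τ h
    rw [hττ, hττ] at h'
    exact add_single_injective x h'
  have hself : ∀ x j, σ (x + Pi.single j 1) j = σ x j := by
    intro x j
    have h := hσ (x + Pi.single j 1) j
    rw [add_assoc x, ZModModule.add_self, add_zero, hσ x j] at h
    apply add_single_injective (τ x + Pi.single (σ x j) 1)
    beta_reduce
    rw [← h, add_assoc, ZModModule.add_self, add_zero]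
  -- The two ways around the square in directions `j` and `k` have the same end, which forces
  -- opposite edges to have the same image direction.
  have hstep : ∀ x j, σ (x + Pi.single j 1) = σ x := by
    intro x j
    ext1 k
    by_cases hkj : k = j
    · rw [hkj, hself]
    · have h1 := hσ (x + Pi.single j 1) k
      rw [add_right_comm, hσ, hσ x k, hσ x j, add_assoc, add_assoc] at h1
      have h2 := congrFun (add_left_cancel h1)
      have hab : σ x j ≠ σ (x + Pi.single j 1) k := by
        rw [← hself x j]
        exact fun h => hkj (hσinj _ h).symm
      have hac : σ x j ≠ σ x k := fun h => hkj (hσinj _ h).symm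
      by_contra hbc
      have h3 := h2 (σ (x + Pi.single j 1) k)
      have h4 := h2 (σ x j)
      simp only [Pi.add_apply, Pi.single_apply] at h3 h4
      grind
  have hσ0 : ∀ x, σ x = σ 0 := by
    intro x
    exact cube_induction (P := fun x => σ x = σ 0) 0 rfl (fun x j h => (hstep x j).trans h) x
  have hinv : Function.Involutive (σ 0) := by
    intro j
    have h := congrArg τ (hσ 0 j)
    rw [hττ, hσ, hττ, hσ0 (τ 0)] at h
    exact (add_single_injective 0 h).symm
  have haff : ∀ x j, τ x j = τ 0 j + x (σ 0 j) := by
    intro x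
    refine cube_induction (P := fun x => ∀ j, τ x j = τ 0 j + x (σ 0 j)) 0 (by simp) ?_ x
    intro x k h j
    rw [hσ, hσ0 x, Pi.add_apply, Pi.add_apply, h, Pi.single_apply, Pi.single_apply, add_assoc,
      if_congr (eq_comm.trans (hinv.eq_iff (x := k) (y := j))) rfl rfl, if_congr eq_comm rfl rfl]
  refine ⟨σ 0, hinv, haff, fun j => ?_⟩
  have h := haff (τ 0) j
  rw [hττ, Pi.zero_apply] at h
  have h2 : ∀ a b : ZMod 2, 0 = a + b → b = a := by decide
  exact h2 _ _ h

theorem exists_endomorphism (hf : IsGraphCovering f)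
    {τ : (Fin d → ZMod 2) → Fin d → ZMod 2} (hτ : ∀ x, f (τ x) = f x)
    (hfib : ∀ x y, f y = f x → y = x ∨ y = τ x)
    {E : (Fin d → ZMod 2) → Fin d → ZMod 2}
    (hE : ∀ x j, ∃ k, E (x + Pi.single j 1) = E x + Pi.single k 1)
    (hEτ : ∀ x, E (τ x) = τ (E x)) : ∃ g : Y →g Y, ∀ x, g (f x) = f (E x) := by
  have hwd : ∀ x y, f y = f x → f (E y) = f (E x) := by
    intro x y h
    obtain rfl | rfl := hfib x y h
    · rfl
    · rw [hEτ, hτ]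
  have hg : ∀ x, f (E (Function.surjInv hf.1 (f x))) = f (E x) :=
    fun x => hwd _ _ (Function.surjInv_eq hf.1 _)
  refine ⟨⟨fun y => f (E (Function.surjInv hf.1 y)), ?_⟩, hg⟩
  intro a b hab
  obtain ⟨x, rfl⟩ := hf.1 a
  obtain ⟨j, rfl⟩ := hf.exists_lift_adj hab
  rw [hg, hg]
  obtain ⟨k, hk⟩ := hE x j
  rw [hk]
  exact f.map_adj (cube_adj_add_single _ _)

/-- Write `τ x = t + x ∘ π`. As `Y` is not bipartite, `∑ t ≠ 0`; the 2-cycles of `π` cancel, so some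
`k` has `π k = k` and `t k = 1`. If some `j` lacked this property, direction `j` could be folded
onto direction `k` by a map commuting with `τ`, giving a non-injective endomorphism of `Y`. -/
theorem eq_add_one_of_isCore (hf : IsGraphCovering f) (hY : ¬ Y.Colorable 2) (hcore : IsCore Y)
    {τ : (Fin d → ZMod 2) → Fin d → ZMod 2} (hne : ∀ x, τ x ≠ x) (hτ : ∀ x, f (τ x) = f x)
    (hfib : ∀ x y, f y = f x → y = x ∨ y = τ x) : (∀ x, τ x = x + 1) ∧ Odd d := by
  obtain ⟨π, hπ, haff, ht⟩ := hf.exists_perm_of_fibre_eq hne hτ hfib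
  set t := τ 0 with ht_def
  have hsum : ∑ j, t j ≠ 0 := by
    intro h0
    refine hY (hf.colorable_two fun x y hxy => ?_)
    obtain rfl | rfl := hfib y x hxy
    · rfl
    · simp only [haff, Finset.sum_add_distrib, h0, zero_add]
      exact Equiv.sum_comp hπ.toPerm y
  have h2 : ∀ a : ZMod 2, a + a = 0 := by decide
  obtain ⟨k, hk, htk⟩ : ∃ k, π k = k ∧ t k ≠ 0 := by
    by_contra! h
    exact hsum (Finset.sum_involution (fun j _ => π j) (fun j _ => by rw [ht, h2])
      (fun j _ hj hπj => hj (h j hπj)) (fun _ _ => Finset.mem_univ _) fun j _ => hπ j)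
  have h01 : ∀ a : ZMod 2, a ≠ 0 → a = 1 := by decide
  have key : ∀ j, π j = j ∧ t j ≠ 0 := by
    intro j
    by_contra hj
    have hjk : j ≠ k := by
      rintro rfl
      exact hj ⟨hk, htk⟩
    have hπjk : π j ≠ k := fun h => hjk (hπ.injective (h.trans hk.symm))
    -- The sum `m` over the orbit of `j` is invariant under `τ`, so it may be added to coordinate
    -- `k`. The constants `t j` and `0` left at `j` and `π j` are compatible with `τ`.
    let m : (Fin d → ZMod 2) → ZMod 2 := fun x => if π j = j then x j else x j + x (π j)
    let E : (Fin d → ZMod 2) → Fin d → ZMod 2 := fun x i =>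
      if i = j then t j else if i = π j then 0 else if i = k then x k + m x else x i
    have ht0 : π j = j → t j = 0 := fun h => by_contra fun h' => hj ⟨h, h'⟩
    have hmτ : ∀ x, m (τ x) = m x := by
      intro x
      simp only [m, haff x]
      split_ifs with h
      · rw [ht0 h, zero_add, h]
      · rw [ht, hπ j]
        linear_combination h2 (t j)
    have hEτ : ∀ x, E (τ x) = τ (E x) := by
      intro x
      ext i
      rw [haff (E x)]
      have hij : π i = j ↔ i = π j := hπ.eq_iff
      have hiπj : π i = π j ↔ i = j := hπ.injective.eq_iff
      have hik : π i = k ↔ i = k := by rw [hπ.eq_iff, hk]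
      simp only [E, hmτ, hij, hiπj, hik, haff x]
      by_cases h1 : i = j
      · subst h1
        by_cases h3 : i = π i
        · rw [if_pos rfl, if_pos h3, ht0 h3.symm, add_zero]
        · rw [if_pos rfl, if_neg h3, if_pos rfl, add_zero]
      · rw [if_neg h1, if_neg h1]
        by_cases h3 : i = π j
        · rw [if_pos h3, if_pos h3, h3, ht, h2]
        · rw [if_neg h3, if_neg h3]
          by_cases h4 : i = k
          · rw [if_pos h4, if_pos h4, h4, hk, add_assoc]
          · rw [if_neg h4, if_neg h4]
    have hm : ∀ x i, m (x + Pi.single i 1) = m x + if i = j ∨ i = π j then 1 else 0 := by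
      intro x i
      simp only [m, Pi.add_apply, Pi.single_apply]
      grind
    have hE : ∀ x i, E (x + Pi.single i 1) =
        E x + Pi.single (if i = j ∨ i = π j then k else i) 1 := by
      intro x i
      ext l
      simp only [E, hm, Pi.add_apply, Pi.single_apply]
      grind
    obtain ⟨g, hg⟩ := hf.exists_endomorphism hτ hfib (fun x i => ⟨_, hE x i⟩) hEτ
    refine hjk (hf.eq_of_apply_add_single_eq (x := 0) ((hcore g).1 ?_))
    rw [hg, hg, hE, hE, if_pos (Or.inl rfl), if_neg]
    rintro (h | h)
    · exact hjk h.symm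
    · exact hπjk h.symm
  have ht1 : ∀ j, t j = 1 := fun j => h01 _ (key j).2
  refine ⟨fun x => ?_, ?_⟩
  · ext j
    rw [haff, ht1, (key j).1, add_comm]
    rfl
  · simpa [ht1, ZMod.natCast_eq_zero_iff_even] using hsum

end IsGraphCovering

theorem foldedCube_succ_adj {n : ℕ} (x y : Fin n → ZMod 2) :
    (foldedCube (n + 1)).Adj x y ↔ x ≠ y ∧ ((∃ j, y = x + Pi.single j 1) ∨ y = x + 1) := by
  have h1 : (∑ i : Fin n, Pi.single i (1 : ZMod 2)) = 1 := Finset.univ_sum_single 1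
  have h : ∀ z : Fin n → ZMod 2, x + y = z ↔ y = x + z := by
    intro z
    constructor
    · rintro rfl; rw [← add_assoc, ZModModule.add_self, zero_add]
    · rintro rfl; rw [← add_assoc, ZModModule.add_self, zero_add]
  change (addCayley (basisVectors n ∪ {∑ i : Fin n, Pi.single i 1})).Adj x y ↔ _
  rw [addCayley_adj, ZModModule.neg_eq_self, ZModModule.neg_eq_self, add_comm y x, or_self, h1]
  simp only [basisVectors, Set.mem_union, Set.mem_ofPred_eq, Set.mem_singleton_iff, h]

theorem IsGraphCovering.nonempty_iso_foldedCube {V : Type u} {Y : SimpleGraph V} {n : ℕ}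
    {f : cube (n + 1) →g Y} (hf : IsGraphCovering f)
    (h : ∀ x y, f y = f x ↔ y = x ∨ y = x + 1) : Nonempty (Y ≃g foldedCube (n + 1)) := by
  let ι : (Fin n → ZMod 2) → Fin (n + 1) → ZMod 2 := fun x => Fin.cons 0 x
  have hι0 : ∀ x, ι x 0 = 0 := fun x => rfl
  have hιs : ∀ x j, ι x (Fin.succ j) = x j := fun x j => rfl
  have hιinj : Function.Injective ι := fun x y hxy => by
    ext j; rw [← hιs x, hxy, hιs]
  have hιe : ∀ x j, ι (x + Pi.single j 1) = ι x + Pi.single (Fin.succ j) 1 := by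
    intro x j
    ext i
    refine Fin.cases ?_ (fun i => ?_) i
    · simp [hι0, (Fin.succ_ne_zero j).symm]
    · simp [hιs, Pi.single_apply]
  have h11 : (1 : ZMod 2) + 1 = 0 := rfl
  -- Representatives have coordinate 0 equal to 0. A step in direction 0 leaves them, and the
  -- antipode returns to them as the all-ones step.
  have hι1 : ∀ x, ι (x + 1) = ι x + Pi.single 0 1 + 1 := by
    intro x
    ext i
    refine Fin.cases ?_ (fun i => ?_) i
    · simp [hι0, h11]
    · simp [hιs]
  have hinj : Function.Injective fun x => f (ι x) := by
    intro x y hxy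
    obtain h' | h' := (h _ _).1 hxy
    · exact hιinj h'
    · have := congrFun h' 0
      simp [hι0] at this
  have hsurj : Function.Surjective fun x => f (ι x) := by
    intro v
    obtain ⟨z, rfl⟩ := hf.1 v
    have h01 : ∀ a : ZMod 2, a ≠ 0 → a = 1 := by decide
    by_cases hz : z 0 = 0
    · refine ⟨fun j => z j.succ, congrArg f ?_⟩
      ext i
      refine Fin.cases ?_ (fun i => ?_) i
      · rw [hι0, hz]
      · rw [hιs]
    · refine ⟨fun j => z j.succ + 1, (h _ _).2 (Or.inr ?_)⟩
      ext i
      refine Fin.cases ?_ (fun i => ?_) i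
      · rw [hι0, Pi.add_apply, h01 _ hz]; rfl
      · rw [hιs]; rfl
  refine ⟨RelIso.symm ⟨Equiv.ofBijective _ ⟨hinj, hsurj⟩, ?_⟩⟩
  intro x y
  change Y.Adj (f (ι x)) (f (ι y)) ↔ (foldedCube (n + 1)).Adj x y
  rw [foldedCube_succ_adj]
  constructor
  · intro hadj
    refine ⟨fun he => hadj.ne (by rw [he]), ?_⟩
    obtain ⟨k, hk⟩ := hf.exists_lift_adj hadj
    rw [eq_comm, h] at hk
    refine Fin.cases (fun hk => ?_) (fun j hk => ?_) k hk
    · obtain hk | hk := hk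
      · have := congrFun hk 0
        simp [hι0] at this
      · right
        rw [← hι1] at hk
        exact hιinj hk
    · rw [← hιe] at hk
      obtain hk | hk := hk
      · exact Or.inl ⟨j, hιinj hk⟩
      · have := congrFun hk 0
        simp [hι0] at this
  · rintro ⟨-, ⟨j, rfl⟩ | rfl⟩
    · rw [hιe]
      exact f.map_adj (cube_adj_add_single _ _)
    · rw [hι1, (h (ι x + Pi.single 0 1) _).2 (Or.inr rfl)]
      exact f.map_adj (cube_adj_add_single _ _)

theorem IsGraphCovering.card_le_and_card_eq_iff [Finite V] [Nonempty V] (hf : IsGraphCovering f)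
    (hcore : IsCore Y) (h1 : ¬ Nonempty (Y ≃g completeGraph (Fin 1)))
    (h2 : ¬ Nonempty (Y ≃g completeGraph (Fin 2))) :
    Nat.card V ≤ 2 ^ (d - 1) ∧
      (Nat.card V = 2 ^ (d - 1) ↔ Odd d ∧ Nonempty (Y ≃g foldedCube d)) := by
  have hY : ¬ Y.Colorable 2 := fun h =>
    (hcore.nonempty_iso_of_colorable_two h).elim h1 h2
  have hle := hf.card_mul_two_le hY
  have hpos : 0 < Nat.card V := Nat.card_pos
  -- For `d = 0` the bound `2 * |V| ≤ 1` is absurd, so the truncated `d - 1` is harmless.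
  obtain _ | n := d
  · rw [pow_zero] at hle
    lia
  rw [pow_succ] at hle
  refine ⟨by simpa using hle, fun h => ?_, fun ⟨_, ⟨e⟩⟩ => ?_⟩
  · choose τ hne hτ using hf.exists_ne_apply_eq hY
    have hfib := hf.eq_or_eq_of_card_mul_two_eq (by rw [h, pow_succ]; rfl) hne hτ
    obtain ⟨hτ1, hodd⟩ := hf.eq_add_one_of_isCore hY hcore hne hτ hfib
    refine ⟨hodd, hf.nonempty_iso_foldedCube fun x y => ⟨fun h => ?_, ?_⟩⟩
    · rw [← hτ1]
      exact hfib x y h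
    · rintro (rfl | rfl)
      · rfl
      · rw [← hτ1, hτ]
  · rw [Nat.card_congr e.toEquiv]
    simp

end CubeQuotients

/-! ### Odd closed walks and odd cycles -/

section OddGirth

variable {V : Type u} {G : SimpleGraph V}

/-- When a new edge closes a cycle with an initial segment of the path, that cycle is either odd, as
wanted, or even and can be cut off without changing parity. -/
theorem exists_isPath_or_exists_odd_cycle {u v : V} (p : G.Walk u v) :
    (∃ q : G.Walk u v, q.IsPath ∧ q.length ≤ p.length ∧ (Even q.length ↔ Even p.length)) ∨
      ∃ (a : V) (c : G.Walk a a), (c.IsCycle ∧ Odd c.length) ∧ c.length ≤ p.length := by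
  classical
  induction p with
  | nil => exact Or.inl ⟨Walk.nil, Walk.IsPath.nil, le_rfl, Iff.rfl⟩
  | @cons a b v hab p ih =>
    obtain ⟨q, hq, hle, hpar⟩ | ⟨z, c, hc, hle⟩ := ih
    · by_cases ha : a ∈ q.support
      · have hlen : (q.takeUntil a ha).length + (q.dropUntil a ha).length = q.length := by
          rw [← Walk.length_append, Walk.take_spec]
        by_cases hodd : Odd (q.takeUntil a ha).length
        · refine Or.inl ⟨q.dropUntil a ha, hq.dropUntil ha, ?_, ?_⟩
          · rw [Walk.length_cons]; lia
          · rw [Walk.length_cons, Nat.even_add_one, ← hpar, ← hlen, Nat.even_add]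
            rw [← Nat.not_even_iff_odd] at hodd
            tauto
        · refine Or.inr ⟨a, Walk.cons hab (q.takeUntil a ha), ⟨?_, ?_⟩, ?_⟩
          · rw [Walk.isCycle_iff_isPath_tail_and_le_length]
            refine ⟨?_, ?_⟩
            · simpa using hq.takeUntil ha
            · have h0 : (q.takeUntil a ha).length ≠ 0 := fun h0 =>
                hab.ne (Walk.eq_of_length_eq_zero h0).symm
              rw [Walk.length_cons]
              rw [Nat.not_odd_iff_even] at hodd
              obtain ⟨k, hk⟩ := hodd
              lia
          · rw [Walk.length_cons]
            exact (Nat.not_odd_iff_even.1 hodd).add_one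
          · rw [Walk.length_cons, Walk.length_cons]; lia
      · refine Or.inl ⟨Walk.cons hab q, hq.cons ha, ?_, ?_⟩
        · rw [Walk.length_cons, Walk.length_cons]; lia
        · rw [Walk.length_cons, Walk.length_cons, Nat.even_add_one, Nat.even_add_one, hpar]
    · exact Or.inr ⟨z, c, hc, by rw [Walk.length_cons]; lia⟩

theorem oddGirth_le_of_odd_closed_walk {u : V} (p : G.Walk u u) (hp : Odd p.length) :
    oddGirth G ≤ p.length := by
  obtain ⟨q, hq, -, hpar⟩ | ⟨a, c, hc, hle⟩ := exists_isPath_or_exists_odd_cycle p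
  · rw [Walk.length_eq_zero_iff.2 (Walk.isPath_iff_nil.1 hq)] at hpar
    exact absurd (hpar.1 Even.zero) (Nat.not_even_iff_odd.2 hp)
  · exact (iInf_le_of_le a (iInf_le_of_le c (iInf_le _ hc))).trans (by exact_mod_cast hle)

theorem exists_cycle_of_oddGirth_eq {g : ℕ} (h : oddGirth G = g) :
    ∃ (a : V) (c : G.Walk a a), Odd c.length ∧ c.length = g := by
  have hlt : oddGirth G < (g + 1 : ℕ) := by rw [h]; exact_mod_cast Nat.lt_succ_self g
  unfold oddGirth at hlt
  simp only [iInf_lt_iff] at hlt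
  obtain ⟨a, c, hc, hlt⟩ := hlt
  refine ⟨a, c, hc.2, le_antisymm ?_ ?_⟩
  · have : c.length < g + 1 := by exact_mod_cast hlt
    lia
  · have := oddGirth_le_of_odd_closed_walk c hc.2
    rw [h] at this
    exact_mod_cast this

end OddGirth

/-! ### Folded cubes from shortest odd cycles -/

namespace TranslationRetract

variable {V : Type u} {Y : SimpleGraph V} {G : Type v} [AddCommGroup G] [Module (ZMod 2) G]

theorem exists_walk_of_finset (R : TranslationRetract Y G) {ι : Type*} (c : ι → G)
    (hc : ∀ j, c j ∈ R.conn) (D : Finset ι) {h h' : G} (hh : h' = h + ∑ j ∈ D, c j) :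
    ∃ p : Y.Walk (R.ret h) (R.ret h'), p.length = D.card := by
  obtain ⟨p, hp⟩ := R.exists_walk_of_list (D.toList.map c) (by simp [hc]) h
  refine ⟨p.copy rfl (by rw [hh, Finset.sum_map_toList]), ?_⟩
  rw [Walk.length_copy, hp, List.length_map, Finset.length_toList]

/-- A shortest odd cycle gives `n + 1 = g` generators with sum zero. Points of the cube differing in
the coordinates `D` have images joined by walks of lengths `|D|` and `n + 1 - |D|`, using either the
generators in `D` or all the others. These lengths have opposite parity, so an unwanted coincidence
or adjacency would produce an odd closed walk shorter than `g`. -/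
theorem nonempty_foldedCube_embedding (R : TranslationRetract Y G) {g : ℕ}
    (hg : oddGirth Y = g) : Nonempty (foldedCube g ↪g Y) := by
  classical
  obtain ⟨a, w, hodd, hw⟩ := exists_cycle_of_oddGirth_eq hg
  obtain ⟨L, hL, hlen, hsum⟩ := R.exists_list_of_walk w
  rw [ZModModule.add_self] at hsum
  rw [hw] at hodd hlen
  obtain _ | n := g
  · exact absurd hodd (by decide)
  obtain ⟨c, hc, hc0⟩ : ∃ c : Fin (n + 1) → G, (∀ j, c j ∈ R.conn) ∧ ∑ j, c j = 0 := by
    have key : ∀ m, L.length = m → ∃ c : Fin m → G, (∀ j, c j ∈ R.conn) ∧ ∑ j, c j = 0 := by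
      rintro _ rfl
      exact ⟨L.get, fun j => hL _ (L.get_mem j), by rw [← List.sum_ofFn, List.ofFn_get, hsum]⟩
    exact key _ hlen
  have hn : Even n := by
    rw [Nat.odd_add_one, Nat.not_odd_iff_even] at hodd
    exact hodd
  have hshort : ∀ {u : V} (p : Y.Walk u u), Odd p.length → n + 1 ≤ p.length := by
    intro u p hp
    have := oddGirth_le_of_odd_closed_walk p hp
    rw [hg] at this
    exact_mod_cast this
  have hc0' : c 0 = ∑ j : Fin n, c j.succ := by
    rw [Fin.sum_univ_succ] at hc0
    rw [← sub_eq_zero, ZModModule.sub_eq_add, hc0]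
  let s : (Fin n → ZMod 2) → G := fun x => ∑ j, x j • c j.succ
  let D : (Fin n → ZMod 2) → (Fin n → ZMod 2) → Finset (Fin n) :=
    fun x y => Finset.univ.filter fun j => y j ≠ x j
  have hsD : ∀ x y, s y = s x + ∑ j ∈ D x y, c j.succ := by
    intro x y
    have h2 : ∀ a b : ZMod 2, b = a + if b ≠ a then 1 else 0 := by decide
    simp only [s, D, Finset.sum_filter]
    rw [← Finset.sum_add_distrib]
    refine Finset.sum_congr rfl fun j _ => ?_
    conv_lhs => rw [h2 (x j) (y j), add_smul]
    split_ifs <;> simp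
  have hsD' : ∀ x y, s y = s x + ∑ j ∈ insert 0 ((D x y)ᶜ.map (Fin.succEmb n)), c j := by
    intro x y
    rw [Finset.sum_insert (by simp), Finset.sum_map, hc0',
      ← Finset.sum_add_sum_compl (D x y), hsD x y]
    simp [add_assoc, ZModModule.add_self]
  have hcardD : ∀ x y, (insert 0 ((D x y)ᶜ.map (Fin.succEmb n))).card + (D x y).card = n + 1 := by
    intro x y
    rw [Finset.card_insert_of_notMem (by simp), Finset.card_map, add_right_comm,
      Finset.card_compl_add_card, Fintype.card_fin]
  have hwalk : ∀ x y, ∃ p : Y.Walk (R.ret (s x)) (R.ret (s y)), p.length = (D x y).card :=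
    fun x y => R.exists_walk_of_finset (fun j : Fin n => c j.succ) (fun j => hc _) _ (hsD x y)
  have hwalk' : ∀ x y, ∃ p : Y.Walk (R.ret (s x)) (R.ret (s y)),
      p.length + (D x y).card = n + 1 := fun x y => by
    obtain ⟨p, hp⟩ := R.exists_walk_of_finset c hc _ (hsD' x y)
    exact ⟨p, by rw [hp, hcardD]⟩
  have hDle : ∀ x y, (D x y).card ≤ n := fun x y =>
    (Finset.card_le_univ _).trans (Fintype.card_fin n).le
  have hD0 : ∀ x y, (D x y).card = 0 → y = x := by
    intro x y h
    ext j
    by_contra hne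
    have : j ∈ D x y := by simp [D, hne]
    rw [Finset.card_eq_zero.1 h] at this
    simp at this
  have hne1 : ∀ a b : ZMod 2, b ≠ a → b = a + 1 := by decide
  have hD1 : ∀ x y, (D x y).card = 1 → ∃ j, y = x + Pi.single j 1 := by
    intro x y h
    obtain ⟨j, hj⟩ := Finset.card_eq_one.1 h
    refine ⟨j, ?_⟩
    have hmem : ∀ i, i ∈ D x y ↔ y i ≠ x i := fun i => by simp [D]
    ext i
    have hi := hmem i
    rw [hj, Finset.mem_singleton] at hi
    rw [Pi.add_apply, Pi.single_apply]
    split_ifs with h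
    · exact hne1 _ _ (hi.1 h)
    · rw [add_zero]; exact not_not.1 (mt hi.2 h)
  have hDn : ∀ x y, (D x y).card = n → y = x + 1 := by
    intro x y h
    have : D x y = Finset.univ := Finset.eq_univ_of_card _ (h.trans (Fintype.card_fin n).symm)
    ext i
    have hi : i ∈ D x y := by rw [this]; exact Finset.mem_univ _
    exact hne1 _ _ (Finset.mem_filter.1 hi).2
  have hinj : Function.Injective fun x => R.ret (s x) := by
    intro x y hxy
    by_contra hne
    have h0 : (D x y).card ≠ 0 := fun h => hne (hD0 x y h).symm
    have := hDle x y
    obtain ⟨p, hp⟩ := hwalk x y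
    obtain ⟨q, hq⟩ := hwalk' x y
    have hp' := hshort (p.copy rfl hxy.symm)
    have hq' := hshort (q.copy rfl hxy.symm)
    rw [Walk.length_copy] at hp' hq'
    rw [Nat.odd_iff] at hp' hq'
    rw [Nat.even_iff] at hn
    -- Both closed walks have length at most `n`, and one of them is odd.
    lia
  refine ⟨⟨⟨fun x => R.ret (s x), hinj⟩, ?_⟩⟩
  intro (x : Fin n → ZMod 2) (y : Fin n → ZMod 2)
  change Y.Adj (R.ret (s x)) (R.ret (s y)) ↔ (foldedCube (n + 1)).Adj x y
  rw [foldedCube_succ_adj]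
  constructor
  · intro hadj
    refine ⟨fun he => hadj.ne (by rw [he]), ?_⟩
    by_contra hnot
    rw [not_or] at hnot
    have h0 : (D x y).card ≠ 0 := fun h => hadj.ne (by rw [hD0 x y h])
    have h1 : (D x y).card ≠ 1 := fun h => hnot.1 (hD1 x y h)
    have h2 : (D x y).card ≠ n := fun h => hnot.2 (hDn x y h)
    have := hDle x y
    obtain ⟨p, hp⟩ := hwalk x y
    obtain ⟨q, hq⟩ := hwalk' x y
    -- The edge closes both walks; the odd one of the results is shorter than `n + 1` because `|D|`
    -- is neither `1` nor `n`.
    have hp' := hshort (Walk.cons hadj.symm p)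
    have hq' := hshort (Walk.cons hadj.symm q)
    rw [Walk.length_cons] at hp' hq'
    rw [Nat.odd_iff] at hp' hq'
    rw [Nat.even_iff] at hn
    lia
  · rintro ⟨-, ⟨j, rfl⟩ | rfl⟩
    · have : s (x + Pi.single j 1) = s x + c j.succ := by
        simp [s, add_smul, Finset.sum_add_distrib, Pi.single_apply, ite_smul]
      rw [this]
      exact R.adj_ret_add (hc _) _
    · have : s (x + 1) = s x + c 0 := by
        simp [s, add_smul, Finset.sum_add_distrib, hc0']
      rw [this]
      exact R.adj_ret_add (hc _) _

end TranslationRetract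

end CubelikeCore

theorem mainTheorem9 {V : Type u} [Finite V] {A : Type v}
    (X : SimpleGraph V) (H : SimpleGraph A)
    (hH : CubelikeCore.IsCubelike H) (hX : CubelikeCore.IsCoreOf X H)
    (W : SimpleGraph V) (hW : CubelikeCore.IsOrbitalGraph X W)
    (K : W.ConnectedComponent) (Y : SimpleGraph K.supp) (hY : Y = W.induce K.supp) :
    ∃ d : ℕ, CubelikeCore.HasValency Y d ∧
      -- 1. homomorphic equivalence to a cubelike graph
      ((∃ (B : Type) (Z : SimpleGraph B),
          CubelikeCore.IsCubelike Z ∧ CubelikeCore.HomEquiv Y Z) ∧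
        Y.cliqueNum ≠ 3 ∧ Y.chromaticNumber ≠ 3) ∧
      -- 2. generous transitivity
      CubelikeCore.GenerouslyTransitive Y ∧
      -- 3. covering by the cube
      ((∃ f : CubelikeCore.cube d →g Y, CubelikeCore.IsGraphCovering f) ∧
        Nat.card K.supp ≤ 2 ^ d) ∧
      -- 4. the degree bound and its case of equality
      (CubelikeCore.IsCore Y →
        ¬ Nonempty (Y ≃g SimpleGraph.completeGraph (Fin 1)) →
        ¬ Nonempty (Y ≃g SimpleGraph.completeGraph (Fin 2)) →
          Nat.card K.supp ≤ 2 ^ (d - 1) ∧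
          (Nat.card K.supp = 2 ^ (d - 1) ↔
            Odd d ∧ Nonempty (Y ≃g CubelikeCore.foldedCube d))) ∧
      -- 5. eigenvalues
      (CubelikeCore.eigenvalues Y ≤ CubelikeCore.eigenvalues (CubelikeCore.cube d) ∧
        ∀ t ∈ CubelikeCore.eigenvalues Y, ∃ k : ℤ, t = k) ∧
      -- 6. equality in the clique-coclique bound
      (Y.indepNum * Y.cliqueNum = Nat.card K.supp →
        ∃ m : ℕ, CubelikeCore.IsCoreOf (SimpleGraph.completeGraph (Fin m)) Y) ∧
      -- 7. hom-idempotence and the shift graph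
      (CubelikeCore.HomIdempotent Y ∧
        (CubelikeCore.IsCore Y →
          (CubelikeCore.HomIdempotent Y ↔
            SimpleGraph.IsContained Y (CubelikeCore.shiftGraph Y)))) ∧
      -- 8. cubelike hulls
      (∀ (T : Type w) [Fintype T] (Z : SimpleGraph T),
        CubelikeCore.MapsTo Z Y → CubelikeCore.MapsTo (CubelikeCore.cubelikeHull Z) Y) ∧
      -- 9. induced folded cubes
      (∀ g : ℕ, CubelikeCore.oddGirth Y = g →
        Nonempty (CubelikeCore.foldedCube g ↪g Y)) := by
  obtain ⟨n, ⟨R₀⟩⟩ := CubelikeCore.exists_translationRetract_orbitalGraph hH hX hW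
  obtain ⟨R⟩ := R₀.nonempty_connectedComponent K
  subst hY
  have hne : Nonempty K.supp := K.nonempty_supp.to_subtype
  obtain ⟨y⟩ := id hne
  have hconn : (W.induce K.supp).Preconnected := K.connected_toSimpleGraph.preconnected
  have hd := R.hasValency y
  obtain ⟨f, hf⟩ := R.exists_isGraphCovering_cube hconn hd
  exact ⟨_, hd, ⟨⟨_, _, ⟨n, R.conn, R.zero_notMem_conn, ⟨SimpleGraph.Iso.refl⟩⟩,
    R.homEquiv_addCayley⟩, R.cliqueNum_ne_three, R.chromaticNumber_ne_three⟩,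
    R.generouslyTransitive, ⟨⟨f, hf⟩, hf.card_le_two_pow⟩,
    fun hc h1 h2 => hf.card_le_and_card_eq_iff hc h1 h2,
    ⟨hf.eigenvalues_le, fun t ht => CubelikeCore.exists_int_of_mem_eigenvalues_cube
      (Multiset.mem_of_le hf.eigenvalues_le ht)⟩,
    R.exists_isCoreOf_completeGraph, ⟨R.homIdempotent, fun _ =>
      ⟨fun _ => R.isContained_shiftGraph, fun _ => R.homIdempotent⟩⟩,
    fun T _ Z h => R.mapsTo_cubelikeHull h, fun g hg => R.nonempty_foldedCube_embedding hg⟩
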